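/- Let $K\in\{\mathbb R,\mathbb C,\mathbb H\}$, $d=\dim_{\mathbb R}K$, and let $G(n)$ be $PO(n,1)$, $PU(n,1)$ or $PSp(n,1)$ respectively, acting on the hyperbolic space $\mathbb H^n_K$ (normalized by $\cosh d(z,w)=|\langle z,w\rangle|/\sqrt{\langle z,z\rangle\langle w,w\rangle}$ on negative vectors of $K^{n,1}$) and on its boundary at infinity $\partial_\infty\mathbb H^n_K$. Assume $d(n-1)\ge 2$ and $m\ge n$. Let $\Gamma\le G(n)$ be a torsion-free uniform lattice and let $(\nu_a)_{a\in\mathbb H^n_K}$ be its Patterson–Sullivan density, that is, a measurable family of probability measures on $\partial_\infty\mathbb H^n_K$ with $\nu_{\gamma a}=\gamma_*\nu_a$ for $\gamma\in\Gamma$ and $\frac{d\nu_a}{d\nu_b}(\xi)=e^{-\delta_\Gamma\beta_b(a,\xi)}$, where $\delta_\Gamma$ is the critical exponent of $\Gamma$ and $\beta_b(a,\xi)=\lim_{s\to\infty}\big(d(a,c(s))-d(b,c(s))\big)$, $c$ being the geodesic ray from $b$ to $\xi$, is the Busemann function. Null sets of $\partial_\infty\mathbb H^n_K$ are taken with respect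 to the common measure class of the $\nu_a$. Let $(X,\mu)$ be a standard Borel probability space without atoms on which $\Gamma$ acts by measure preserving transformations. A measurable cocycle is a measurable map $\sigma:\Gamma\times X\to G(m)$ such that $\sigma(\gamma_1\gamma_2,x)=\sigma(\gamma_1,\gamma_2x)\sigma(\gamma_2,x)$ for all $\gamma_1,\gamma_2\in\Gamma$ and almost every $x$. A boundary map of $\sigma$ is a measurable map $\phi:\partial_\infty\mathbb H^n_K\times X\to\partial_\infty\mathbb H^m_K$ such that, for every $\gamma\in\Gamma$, $\phi(\gamma\xi,\gamma x)=\sigma(\gamma,x)\phi(\xi,x)$ for almost every $(\xi,x)$. The barycenter $\mathrm{bar}(\lambda)$ of a probability measure $\lambda$ on $\partial_\infty\mathbb H^m_K$ without atoms of mass $\ge 1/2$ is the unique minimum point of $a\mapsto\int\beta_o(a,\xi)\,d\lambda(\xi)$, where $o$ is a fixed basepoint. A measurable map $F:\mathbb H^n_K\times X\to\mathbb H^m_K$ is the natural map of $\sigma$ if $\sigma$ has an essentially unique boundary map $\phi$, almost every slice $\phi_x=\phi(\cdot,x)$ is essentially injective (injective on a set of full measure), and, for almost every $x\in X$, $F(a,x)=\mathrm{bar}((\phi_x)_*\nu_a)$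 for every $a\in\mathbb H^n_K$. Let $\sigma:\Gamma\times X\to G(m)$ be a measurable cocycle that admits a natural map $F$, and let $f:X\to G(m)$ be a measurable map. Then $\sigma^f(\gamma,x)=f(\gamma x)^{-1}\sigma(\gamma,x)f(x)$ is a measurable cocycle and its natural map is $$F^f:\mathbb H^n_K\times X\to\mathbb H^m_K,\qquad F^f(a,x)=f(x)^{-1}F(a,x),$$ that is, $F^f$ is a natural map of $\sigma^f$, and every natural map of $\sigma^f$ agrees with $F^f(\cdot,x)$ on all of $\mathbb H^n_K$ for almost every $x\in X$. -/

import Mathlib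

open MeasureTheory Filter Topology
open scoped Quaternion Matrix ENNReal

namespace HypCocycle

noncomputable section

/-! ### The division algebras `ℝ`, `ℂ`, `ℍ` -/

/-- The three families `PO(n,1)`, `PU(n,1)`, `PSp(n,1)`. -/
inductive Family
  | real
  | complex
  | quaternionic

/-- The division algebra of the family: `ℝ`, `ℂ` or the Hamilton quaternions `ℍ[ℝ]`. -/
def Family.K : Family → Type
  | .real => ℝ
  | .complex => ℂ
  | .quaternionic => ℍ[ℝ]

instance : (t : Family) → NormedDivisionRing t.K
  | .real => inferInstanceAs (NormedDivisionRing ℝ)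
  | .complex => inferInstanceAs (NormedDivisionRing ℂ)
  | .quaternionic => inferInstanceAs (NormedDivisionRing ℍ[ℝ])

instance : (t : Family) → NormedAlgebra ℝ t.K
  | .real => inferInstanceAs (NormedAlgebra ℝ ℝ)
  | .complex => inferInstanceAs (NormedAlgebra ℝ ℂ)
  | .quaternionic => inferInstanceAs (NormedAlgebra ℝ ℍ[ℝ])

/-- Conjugation: trivial on `ℝ`, the usual one on `ℂ` and on `ℍ`. -/
instance : (t : Family) → StarRing t.K
  | .real => inferInstanceAs (StarRing ℝ)
  | .complex => inferInstanceAs (StarRing ℂ)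
  | .quaternionic => inferInstanceAs (StarRing ℍ[ℝ])

instance : (t : Family) → FiniteDimensional ℝ t.K
  | .real => inferInstanceAs (FiniteDimensional ℝ ℝ)
  | .complex => inferInstanceAs (FiniteDimensional ℝ ℂ)
  | .quaternionic => inferInstanceAs (FiniteDimensional ℝ ℍ[ℝ])

theorem Family.star_mul_self : (t : Family) → (a : t.K) → star a * a = algebraMap ℝ t.K (‖a‖ ^ 2)
  | .real, a => by
      change ℝ at a
      change a * a = ‖a‖ ^ 2
      rw [Real.norm_eq_abs, sq_abs, sq]
  | .complex, a => by
      change ℂ at a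
      change (starRingEnd ℂ) a * a = ((‖a‖ ^ 2 : ℝ) : ℂ)
      rw [Complex.conj_mul']; push_cast; rfl
  | .quaternionic, a => by
      change ℍ[ℝ] at a
      change star a * a = ((‖a‖ ^ 2 : ℝ) : ℍ[ℝ])
      rw [Quaternion.star_mul_self, Quaternion.normSq_eq_norm_mul_self, sq]

variable (t : Family) (n : ℕ)

/-! ### The isometry groups -/

/-- Index set of the coordinates of `K^{n,1}`. -/
abbrev Idx := Fin n ⊕ Unit

/-- The Gram matrix `diag(1,…,1,-1)`. -/
def J : Matrix (Idx n) (Idx n) t.K := Matrix.diagonal (Sum.elim (fun _ => 1) (fun _ => -1))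

/-- `O(n,1)`, `U(n,1)`, `Sp(n,1)`: the invertible matrices over `K` preserving the Hermitian form
`⟨v,w⟩ = ∑ v̄ᵢ wᵢ - v̄ₙ₊₁ wₙ₊₁` on column vectors (scalars act on the right). -/
def U : Subgroup (Matrix (Idx n) (Idx n) t.K)ˣ where
  carrier := {A | (A : Matrix (Idx n) (Idx n) t.K)ᴴ * J t n * A = J t n}
  one_mem' := by simp
  mul_mem' := by
    intro A B hA hB
    simp only [Set.mem_ofPred_eq] at hA hB ⊢
    rw [Units.val_mul, Matrix.conjTranspose_mul]
    calc _ = (B : Matrix (Idx n) (Idx n) t.K)ᴴ *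
          ((A : Matrix (Idx n) (Idx n) t.K)ᴴ * J t n * A) * B := by noncomm_ring
      _ = _ := by rw [hA, hB]
  inv_mem' := by
    intro A hA
    simp only [Set.mem_ofPred_eq] at hA ⊢
    have h1 : (A : Matrix (Idx n) (Idx n) t.K) * (A⁻¹ : (Matrix (Idx n) (Idx n) t.K)ˣ) = 1 :=
      A.mul_inv
    have h2 : ((A⁻¹ : (Matrix (Idx n) (Idx n) t.K)ˣ) : Matrix (Idx n) (Idx n) t.K)ᴴ *
        (A : Matrix (Idx n) (Idx n) t.K)ᴴ = 1 := by
      rw [← Matrix.conjTranspose_mul, h1, Matrix.conjTranspose_one]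
    set B := ((A⁻¹ : (Matrix (Idx n) (Idx n) t.K)ˣ) : Matrix (Idx n) (Idx n) t.K)
    calc Bᴴ * J t n * B
        = Bᴴ * ((A : Matrix (Idx n) (Idx n) t.K)ᴴ * J t n * A) * B := by rw [hA]
      _ = (Bᴴ * (A : Matrix (Idx n) (Idx n) t.K)ᴴ) * J t n * (A * B) := by noncomm_ring
      _ = J t n := by rw [h1, h2, one_mul, mul_one]

/-- The subgroup of scalar matrices `c • 1` with `c` in the centre of `K`
(that is `±1` for `ℝ` and `ℍ`, the unit circle for `ℂ`). -/
def Z : Subgroup (U t n) where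
  carrier := {A | ∃ c ∈ Subring.center t.K,
    ((A : (Matrix (Idx n) (Idx n) t.K)ˣ) : Matrix (Idx n) (Idx n) t.K) = Matrix.scalar _ c}
  one_mem' := ⟨1, Subring.one_mem _, by simp⟩
  mul_mem' := by
    rintro A B ⟨c, hc, hA⟩ ⟨e, he, hB⟩
    refine ⟨c * e, Subring.mul_mem _ hc he, ?_⟩
    rw [Subgroup.coe_mul, Units.val_mul, hA, hB, map_mul]
  inv_mem' := by
    rintro A ⟨c, hc, hA⟩
    refine ⟨c⁻¹, Set.inv_mem_center hc, ?_⟩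
    have hc0 : c ≠ 0 := by
      rintro rfl
      have h := (A : (Matrix (Idx n) (Idx n) t.K)ˣ).mul_inv
      rw [hA, map_zero, zero_mul] at h
      have := congrFun (congrFun h (Sum.inr ())) (Sum.inr ())
      simp at this
    rw [Subgroup.coe_inv]
    apply Units.inv_eq_of_mul_eq_one_right
    rw [hA, ← map_mul, mul_inv_cancel₀ hc0, map_one]

theorem scalar_comm {c : t.K} (hc : c ∈ Subring.center t.K) (M : Matrix (Idx n) (Idx n) t.K) :
    Matrix.scalar _ c * M = M * Matrix.scalar _ c := by
  ext i j
  simp [Matrix.scalar_apply, Matrix.diagonal_mul, Matrix.mul_diagonal,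
    (Subring.mem_center_iff.1 hc (M i j))]

instance : (Z t n).Normal where
  conj_mem := by
    rintro A ⟨c, hc, hA⟩ g
    refine ⟨c, hc, ?_⟩
    rw [Subgroup.coe_mul, Subgroup.coe_mul, Units.val_mul, Units.val_mul, hA, ← scalar_comm t n hc,
      mul_assoc, ← Units.val_mul, ← Subgroup.coe_mul, mul_inv_cancel]
    simp

/-- `G(n)`: the group `PO(n,1)`, `PU(n,1)` or `PSp(n,1)`, with its quotient topology. -/
def G : Type := U t n ⧸ Z t n

instance : Group (G t n) := inferInstanceAs (Group (U t n ⧸ Z t n))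
instance : TopologicalSpace (G t n) := inferInstanceAs (TopologicalSpace (U t n ⧸ Z t n))
instance : IsTopologicalGroup (G t n) := inferInstanceAs (IsTopologicalGroup (U t n ⧸ Z t n))
instance : MeasurableSpace (G t n) := borel _
instance : BorelSpace (G t n) := ⟨rfl⟩

/-! ### Hyperbolic space and its boundary at infinity -/

/-- The hyperbolic space over `K` of `K`-dimension `n`, in the ball model: `z` stands for the
negative line spanned by `(z, 1)` in `K^{n,1}`. -/
def Hyp : Type := {z : Fin n → t.K // ∑ i, ‖z i‖ ^ 2 < 1}

/-- The boundary at infinity: the unit sphere; `z` stands for the isotropic line spanned by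
`(z, 1)`. -/
def Bdry : Type := {z : Fin n → t.K // ∑ i, ‖z i‖ ^ 2 = 1}

instance : TopologicalSpace (Hyp t n) :=
  inferInstanceAs (TopologicalSpace {z : Fin n → t.K // ∑ i, ‖z i‖ ^ 2 < 1})
instance : MeasurableSpace (Hyp t n) := borel _
instance : BorelSpace (Hyp t n) := ⟨rfl⟩
instance : TopologicalSpace (Bdry t n) :=
  inferInstanceAs (TopologicalSpace {z : Fin n → t.K // ∑ i, ‖z i‖ ^ 2 = 1})
instance : MeasurableSpace (Bdry t n) := borel _
instance : BorelSpace (Bdry t n) := ⟨rfl⟩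

variable {t n}

/-- The vector `(z, 1)`. -/
def lift (z : Fin n → t.K) : Idx n → t.K := Sum.elim z (fun _ => 1)

/-- The fractional linear action: the affine coordinates of the line spanned by `A (z, 1)`. -/
def act (A : Matrix (Idx n) (Idx n) t.K) (z : Fin n → t.K) : Fin n → t.K :=
  fun i => (A *ᵥ lift z) (Sum.inl i) * ((A *ᵥ lift z) (Sum.inr ()))⁻¹

theorem form_eq (v : Idx n → t.K) :
    star v ⬝ᵥ (J t n *ᵥ v) =
      algebraMap ℝ t.K (∑ i, ‖v (Sum.inl i)‖ ^ 2 - ‖v (Sum.inr ())‖ ^ 2) := by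
  rw [map_sub, map_sum]
  simp only [J, Matrix.mulVec_diagonal, dotProduct, Fintype.sum_sum_type, Pi.star_apply,
    Sum.elim_inl, Sum.elim_inr, one_mul, neg_mul, mul_neg, Family.star_mul_self]
  rw [sub_eq_add_neg]
  simp

theorem norm_mulVec (A : U t n) (v : Idx n → t.K) :
    ∑ i, ‖(A.1.1 *ᵥ v) (Sum.inl i)‖ ^ 2 - ‖(A.1.1 *ᵥ v) (Sum.inr ())‖ ^ 2 =
      ∑ i, ‖v (Sum.inl i)‖ ^ 2 - ‖v (Sum.inr ())‖ ^ 2 := by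
  apply (algebraMap ℝ t.K).injective
  rw [← form_eq, ← form_eq, Matrix.star_mulVec, ← Matrix.dotProduct_mulVec, Matrix.mulVec_mulVec,
    Matrix.mulVec_mulVec]
  have h : (A.1.1)ᴴ * J t n * A.1.1 = J t n := A.2
  rw [h]

theorem denom_ne_zero (A : U t n) {z : Fin n → t.K} (hz : ∑ i, ‖z i‖ ^ 2 ≤ 1) :
    (A.1.1 *ᵥ lift z) (Sum.inr ()) ≠ 0 := by
  intro h0
  have h := norm_mulVec A (lift z)
  rw [h0] at h
  simp only [lift, Sum.elim_inl, Sum.elim_inr, norm_zero, norm_one] at h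
  have hs : ∑ i, ‖(A.1.1 *ᵥ lift z) (Sum.inl i)‖ ^ 2 = 0 := by
    apply le_antisymm _ (Finset.sum_nonneg fun i _ => by positivity)
    simp only [lift]
    linarith
  have hw : A.1.1 *ᵥ lift z = 0 := by
    funext i
    rcases i with i | i
    · have := (Finset.sum_eq_zero_iff_of_nonneg (fun i _ => by positivity)).1 hs i (Finset.mem_univ i)
      simpa using this
    · exact h0
  have hv : lift z = 0 := by
    have h1 : (A.1⁻¹).1 *ᵥ (A.1.1 *ᵥ lift z) = 0 := by rw [hw, Matrix.mulVec_zero]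
    rwa [Matrix.mulVec_mulVec, Units.inv_mul, Matrix.one_mulVec] at h1
  have := congrFun hv (Sum.inr ())
  simp [lift] at this

theorem norm_act (A : U t n) {z : Fin n → t.K} (hz : ∑ i, ‖z i‖ ^ 2 ≤ 1) :
    ∑ i, ‖act A.1.1 z i‖ ^ 2 - 1 =
      (∑ i, ‖z i‖ ^ 2 - 1) / ‖(A.1.1 *ᵥ lift z) (Sum.inr ())‖ ^ 2 := by
  have h0 : ‖(A.1.1 *ᵥ lift z) (Sum.inr ())‖ ≠ 0 := norm_ne_zero_iff.2 (denom_ne_zero A hz)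
  have h := norm_mulVec A (lift z)
  have hl : ∑ i, ‖lift z (Sum.inl i)‖ ^ 2 - ‖lift z (Sum.inr ())‖ ^ 2 = ∑ i, ‖z i‖ ^ 2 - 1 := by
    simp [lift]
  rw [← hl, ← h]
  simp only [act, norm_mul, norm_inv, mul_pow, ← Finset.sum_mul]
  field_simp

theorem lift_act (A : U t n) {z : Fin n → t.K} (hz : ∑ i, ‖z i‖ ^ 2 ≤ 1) :
    lift (act A.1.1 z) = fun i => (A.1.1 *ᵥ lift z) i * ((A.1.1 *ᵥ lift z) (Sum.inr ()))⁻¹ := by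
  funext i
  rcases i with i | i
  · rfl
  · exact (mul_inv_cancel₀ (denom_ne_zero A hz)).symm

theorem act_mul (A B : U t n) {z : Fin n → t.K} (hz : ∑ i, ‖z i‖ ^ 2 ≤ 1) :
    act (A * B).1.1 z = act A.1.1 (act B.1.1 z) := by
  have hB := denom_ne_zero B hz
  have key : ∀ i, (A.1.1 *ᵥ lift (act B.1.1 z)) i =
      ((A * B).1.1 *ᵥ lift z) i * ((B.1.1 *ᵥ lift z) (Sum.inr ()))⁻¹ := by
    intro i
    rw [lift_act B hz, Subgroup.coe_mul, Units.val_mul, ← Matrix.mulVec_mulVec]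
    simp only [Matrix.mulVec, dotProduct, Finset.sum_mul, mul_assoc]
  funext i
  simp only [act] at key ⊢
  rw [key, key, mul_inv_rev, inv_inv, mul_assoc, inv_mul_cancel_left₀ hB]

theorem act_one (z : Fin n → t.K) : act (1 : U t n).1.1 z = z := by
  funext i
  simp [act, lift]

theorem act_center {A : U t n} (hA : A ∈ Z t n) (z : Fin n → t.K) : act A.1.1 z = z := by
  obtain ⟨c, hc, h⟩ := hA
  have hc0 : c ≠ 0 := by
    rintro rfl
    have h' := A.1.mul_inv
    rw [h, map_zero, zero_mul] at h'
    have := congrFun (congrFun h' (Sum.inr ())) (Sum.inr ())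
    simp at this
  funext i
  simp only [act, h, Matrix.scalar_apply, Matrix.mulVec_diagonal, lift, Sum.elim_inl, Sum.elim_inr,
    mul_one]
  rw [← Subring.mem_center_iff.1 hc (z i), mul_assoc, mul_inv_cancel₀ hc0, mul_one]

instance : MulAction (U t n) (Hyp t n) where
  smul A z := ⟨act A.1.1 z.1, by
    have h := norm_act A z.2.le
    have h0 : 0 < ‖(A.1.1 *ᵥ lift z.1) (Sum.inr ())‖ := norm_pos_iff.2 (denom_ne_zero A z.2.le)
    have : (∑ i, ‖z.1 i‖ ^ 2 - 1) / ‖(A.1.1 *ᵥ lift z.1) (Sum.inr ())‖ ^ 2 < 0 :=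
      div_neg_of_neg_of_pos (sub_neg.2 z.2) (by positivity)
    linarith⟩
  one_smul z := Subtype.ext (act_one z.1)
  mul_smul A B z := Subtype.ext (act_mul A B z.2.le)

instance : MulAction (U t n) (Bdry t n) where
  smul A z := ⟨act A.1.1 z.1, by
    have h := norm_act A z.2.le
    rw [z.2, sub_self, zero_div] at h
    linarith⟩
  one_smul z := Subtype.ext (act_one z.1)
  mul_smul A B z := Subtype.ext (act_mul A B z.2.le)

/-- The isometric action of `G(n)` on hyperbolic space. -/
instance : MulAction (G t n) (Hyp t n) :=
  MulAction.compHom (Hyp t n) (QuotientGroup.lift (Z t n) (MulAction.toPermHom (U t n) (Hyp t n))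
    (fun _ hA => Equiv.ext fun z => Subtype.ext (act_center hA z.1)))

/-- The action of `G(n)` on the boundary at infinity. -/
instance : MulAction (G t n) (Bdry t n) :=
  MulAction.compHom (Bdry t n) (QuotientGroup.lift (Z t n) (MulAction.toPermHom (U t n) (Bdry t n))
    (fun _ hA => Equiv.ext fun z => Subtype.ext (act_center hA z.1)))

/-- The basepoint `o`: the centre of the ball. -/
def origin : Hyp t n := ⟨fun _ => 0, by simp⟩

/-- The hyperbolic distance,
`cosh d(z,w) = |⟨(z,1),(w,1)⟩| / √(⟨(z,1),(z,1)⟩ ⟨(w,1),(w,1)⟩)`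
(curvature `-1` over `ℝ`, between `-4` and `-1` over `ℂ` and `ℍ`). -/
def hdist (z w : Hyp t n) : ℝ :=
  Real.arcosh (‖1 - ∑ i, star (z.1 i) * w.1 i‖ /
    √((1 - ∑ i, ‖z.1 i‖ ^ 2) * (1 - ∑ i, ‖w.1 i‖ ^ 2)))

/-! ### Busemann functions and barycenters -/

/-- `c` restricted to `[0, ∞)` is a unit speed geodesic ray from `b` to the boundary point `ξ`. -/
structure IsGeodesicRay (c : ℝ → Hyp t n) (b : Hyp t n) (ξ : Bdry t n) : Prop where
  start : c 0 = b
  isometry : ∀ s r : ℝ, 0 ≤ s → 0 ≤ r → hdist (c s) (c r) = |s - r|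
  tendsto : Tendsto (fun s => (c s).1) atTop (𝓝 ξ.1)

/-- The Busemann function `β_b(a, ξ)` pointed at `b`: the limit of `d(a, c(s)) - d(b, c(s))` along a
geodesic ray `c` from `b` to `ξ`. -/
def busemann (b a : Hyp t n) (ξ : Bdry t n) : ℝ :=
  Classical.epsilon fun r : ℝ => ∃ c : ℝ → Hyp t n, IsGeodesicRay c b ξ ∧
    Tendsto (fun s => hdist a (c s) - hdist b (c s)) atTop (𝓝 r)

/-- `Λ_ν(a) = ∫ β_o(a, ξ) dν(ξ)`. -/
def bFunctional (ν : Measure (Bdry t n)) (a : Hyp t n) : ℝ := ∫ ξ, busemann origin a ξ ∂ν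

/-- `p` is the barycenter of the measure `ν`: `ν` has no atom of mass at least `1/2` and `p` is the
unique point at which `Λ_ν` attains its minimum. -/
def IsBarycenter (ν : Measure (Bdry t n)) (p : Hyp t n) : Prop :=
  (∀ ξ, ν {ξ} < 1 / 2) ∧ ∀ q, q ≠ p → bFunctional ν p < bFunctional ν q

/-! ### Lattices and Patterson-Sullivan densities -/

/-- `Γ` is a torsion-free uniform lattice: discrete, cocompact, and without non-trivial elements of
finite order. -/
structure IsTorsionFreeUniformLattice (Γ : Subgroup (G t n)) : Prop where
  discrete : DiscreteTopology Γ
  cocompact : CompactSpace (G t n ⧸ Γ)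
  torsionFree : ∀ γ ∈ Γ, γ ≠ 1 → ¬ IsOfFinOrder γ

/-- The critical exponent `δ_Γ`, through the Poincaré series at the basepoint. -/
def critExp (Γ : Subgroup (G t n)) : ℝ :=
  sInf {s : ℝ | 0 < s ∧ Summable fun γ : Γ => Real.exp (-s * hdist (γ • (origin : Hyp t n)) origin)}

/-- `α`-conformal densities of probability measures for `Γ`. -/
structure IsConformalDensity (Γ : Subgroup (G t n)) (α : ℝ) (ν : Hyp t n → Measure (Bdry t n)) :
    Prop where
  pos : 0 < α
  measurable : Measurable ν
  prob : ∀ a, IsProbabilityMeasure (ν a)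
  equivariant : ∀ (γ : Γ) (a : Hyp t n), ν (γ • a) = (ν a).map (fun ξ => γ • ξ)
  absCont : ∀ a b, a ≠ b → ν a ≪ ν b
  density : ∀ a b, a ≠ b →
    (ν a).rnDeriv (ν b) =ᵐ[ν b] fun ξ => ENNReal.ofReal (Real.exp (-α * busemann b a ξ))

/-- Patterson-Sullivan densities: `δ_Γ`-conformal densities. -/
def IsPattersonSullivan (Γ : Subgroup (G t n)) (ν : Hyp t n → Measure (Bdry t n)) : Prop :=
  IsConformalDensity Γ (critExp Γ) ν

/-! ### Cocycles, boundary maps and natural maps -/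

section Cocycle

variable {m : ℕ} {Γ : Subgroup (G t n)} {X : Type*} [MeasurableSpace X] [MulAction Γ X]

/-- Measurable cocycles `Γ × X → G(m)`. (For discrete `Γ` the map `γ ↦ σ(γ, ·)` is automatically
continuous.) -/
structure IsCocycle (μ : Measure X) (σ : Γ × X → G t m) : Prop where
  measurable : Measurable σ
  cocycle : ∀ γ₁ γ₂ : Γ, ∀ᵐ x ∂μ, σ (γ₁ * γ₂, x) = σ (γ₁, γ₂ • x) * σ (γ₂, x)

/-- The twisted cocycle `σ^f(γ, x) = f(γx)⁻¹ σ(γ, x) f(x)`. -/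
def twist (σ : Γ × X → G t m) (f : X → G t m) : Γ × X → G t m :=
  fun p => (f (p.1 • p.2))⁻¹ * σ p * f p.2

/-- Boundary maps for `σ`: measurable `σ`-equivariant maps `∂H^n × X → ∂H^m`. The boundary
`∂H^n` carries a measure `κ`, of which only the null sets matter. -/
structure IsBoundaryMap (κ : Measure (Bdry t n)) (μ : Measure X) (σ : Γ × X → G t m)
    (φ : Bdry t n × X → Bdry t m) : Prop where
  measurable : Measurable φ
  equivariant : ∀ γ : Γ, ∀ᵐ p ∂(κ.prod μ), φ (γ • p.1, γ • p.2) = σ (γ, p.2) • φ p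

/-- Essential injectivity: injectivity on a set of full measure. -/
def EssInjective {A B : Type*} [MeasurableSpace A] (κ : Measure A) (h : A → B) : Prop :=
  ∃ S : Set A, κ Sᶜ = 0 ∧ Set.InjOn h S

/-- `F` is the natural map of the cocycle `σ` (built with the Patterson-Sullivan density `ν`):
`σ` has an essentially unique boundary map `φ`, almost every slice `φ_x` is essentially injective,
and `F` is a measurable map such that, for almost every `x` and for every `a`, the point `F(a, x)`
is the barycenter of `(φ_x)_* ν_a`. Null sets of `∂H^n` are those of the Patterson-Sullivan
measures, which all have the same null sets. -/
def IsNaturalMap (ν : Hyp t n → Measure (Bdry t n)) (μ : Measure X) (σ : Γ × X → G t m)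
    (F : Hyp t n × X → Hyp t m) : Prop :=
  Measurable F ∧ ∃ φ : Bdry t n × X → Bdry t m,
    IsBoundaryMap (ν origin) μ σ φ ∧
    (∀ ψ, IsBoundaryMap (ν origin) μ σ ψ → ψ =ᵐ[(ν origin).prod μ] φ) ∧
    (∀ᵐ x ∂μ, EssInjective (ν origin) fun ξ => φ (ξ, x)) ∧
    ∀ᵐ x ∂μ, ∀ a, IsBarycenter ((ν a).map fun ξ => φ (ξ, x)) (F (a, x))

end Cocycle

end

end HypCocycle

namespace HypCocycle

noncomputable section

/-! ### Topology of the groups, of hyperbolic space and of its boundary -/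

section Topology

variable (t : Family) (n : ℕ)

/-! The point is that barycenters are equivariant: `bar (g_* λ) = g • bar λ` for `g` in `G(m)`.
Moving both `a` and `ξ` by `g` changes `β_o(a, ξ)` by a term that does not depend on `a`
(`log_horo_smul`), so the functional minimized by the barycenter changes by a constant
(`bFunctional_map_smul`). To make this available, the Busemann function is computed as the logarithm
of an explicit ratio built from the Hermitian form (`busemann_origin`), whose behaviour under `G` is
read off from invariance of the form (`horo_act`).

On the cocycle side, `φ ↦ f(x)⁻¹ φ` turns boundary maps of `σ` into boundary maps of `σ^f`, and
twisting by `f⁻¹` goes back, so essential uniqueness transfers. Each slice is only composed with a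
bijection, which preserves essential injectivity, and equivariance of the barycenter identifies the
natural map.

For uniqueness, two boundary maps agree almost everywhere, so almost all of their slices agree
`ν_o`-a.e. As every `ν_a ≪ ν_o`, these slices have the same push-forward of `ν_a` for all `a` at
once, hence the same barycenters. -/

instance : ProperSpace t.K := FiniteDimensional.proper ℝ t.K

instance : SecondCountableTopology (Hyp t n) :=
  inferInstanceAs (SecondCountableTopology {z : Fin n → t.K // ∑ i, ‖z i‖ ^ 2 < 1})

instance : SecondCountableTopology (Bdry t n) :=
  inferInstanceAs (SecondCountableTopology {z : Fin n → t.K // ∑ i, ‖z i‖ ^ 2 = 1})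

instance : T2Space (Bdry t n) :=
  inferInstanceAs (T2Space {z : Fin n → t.K // ∑ i, ‖z i‖ ^ 2 = 1})

instance : CompactSpace (Bdry t n) := by
  have hc : IsClosed {z : Fin n → t.K | ∑ i, ‖z i‖ ^ 2 = 1} :=
    isClosed_eq (by fun_prop) continuous_const
  have hb : {z : Fin n → t.K | ∑ i, ‖z i‖ ^ 2 = 1} ⊆ Metric.closedBall 0 1 := by
    intro z hz
    rw [mem_closedBall_zero_iff, pi_norm_le_iff_of_nonneg zero_le_one]
    intro i
    have hz' : ∑ i, ‖z i‖ ^ 2 = 1 := hz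
    have h : ‖z i‖ ^ 2 ≤ 1 :=
      hz' ▸ Finset.single_le_sum (f := fun i => ‖z i‖ ^ 2) (fun _ _ => by positivity)
        (Finset.mem_univ i)
    exact (sq_le_one_iff₀ (norm_nonneg _)).1 h
  exact isCompact_iff_compactSpace.1 ((isCompact_closedBall _ _).of_isClosed_subset hc hb)

instance : SecondCountableTopology (Matrix (Idx n) (Idx n) t.K) :=
  inferInstanceAs (SecondCountableTopology (Idx n → Idx n → t.K))

instance : SecondCountableTopology (Matrix (Idx n) (Idx n) t.K)ˣ :=
  haveI : SecondCountableTopology (Matrix (Idx n) (Idx n) t.K)ᵐᵒᵖ :=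
    MulOpposite.opHomeomorph.symm.isEmbedding.secondCountableTopology
  Units.isEmbedding_embedProduct.secondCountableTopology

instance : SecondCountableTopology (U t n) :=
  IsEmbedding.subtypeVal.secondCountableTopology

/-- Second countability makes Borel structures compatible with products, so that products and
actions of measurable `G`-valued maps are measurable. -/
instance : SecondCountableTopology (G t n) :=
  (QuotientGroup.isOpenQuotientMap_mk (N := Z t n)).isQuotientMap.secondCountableTopology
    QuotientGroup.isOpenQuotientMap_mk.isOpenMap

variable {t n}

theorem continuous_act_subtype {p : (Fin n → t.K) → Prop} (hp : ∀ z, p z → ∑ i, ‖z i‖ ^ 2 ≤ 1) :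
    Continuous fun q : U t n × {z : Fin n → t.K // p z} => act q.1.1.1 q.2.1 := by
  have hl : Continuous fun q : U t n × {z : Fin n → t.K // p z} => lift q.2.1 := by
    refine continuous_pi fun i => ?_
    rcases i with i | i
    · exact (continuous_apply i).comp (continuous_subtype_val.comp continuous_snd)
    · exact continuous_const
  have hA : Continuous fun q : U t n × {z : Fin n → t.K // p z} => q.1.1.1 :=
    Units.continuous_val.comp (continuous_subtype_val.comp continuous_fst)
  have hv : Continuous fun q : U t n × {z : Fin n → t.K // p z} => q.1.1.1 *ᵥ lift q.2.1 :=
    hA.matrix_mulVec hl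
  refine continuous_pi fun i => ?_
  exact ((continuous_apply _).comp hv).mul
    (((continuous_apply _).comp hv).inv₀ fun q => denom_ne_zero q.1 (hp _ q.2.2))

instance : ContinuousSMul (U t n) (Hyp t n) :=
  ⟨Continuous.subtype_mk (continuous_act_subtype fun _ h => h.le) _⟩

instance : ContinuousSMul (U t n) (Bdry t n) :=
  ⟨Continuous.subtype_mk (continuous_act_subtype fun _ h => h.le) _⟩

/-- A product of a quotient map with an identity need not be a quotient map; here openness of the
projection saves it. Joint continuity of the action then descends from `U` to `G`. -/
theorem isOpenQuotientMap_mk_prodMap_id (Y : Type*) [TopologicalSpace Y] :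
    IsOpenQuotientMap
      (Prod.map (fun A : U t n => (QuotientGroup.mk A : U t n ⧸ Z t n)) (id : Y → Y)) :=
  (QuotientGroup.isOpenQuotientMap_mk (N := Z t n)).prodMap .id

instance : ContinuousSMul (G t n) (Hyp t n) :=
  ⟨(isOpenQuotientMap_mk_prodMap_id (Hyp t n)).isQuotientMap.continuous_iff.2
    (continuous_smul (M := U t n) (X := Hyp t n))⟩

instance : ContinuousSMul (G t n) (Bdry t n) :=
  ⟨(isOpenQuotientMap_mk_prodMap_id (Bdry t n)).isQuotientMap.continuous_iff.2
    (continuous_smul (M := U t n) (X := Bdry t n))⟩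

theorem countable_of_discreteTopology (Γ : Subgroup (G t n)) [DiscreteTopology Γ] :
    Countable Γ :=
  TopologicalSpace.separableSpace_iff_countable.1 inferInstance

end Topology

/-! ### Busemann functions -/

section Busemann

variable {t : Family} {n : ℕ}

theorem norm_star_eq (a : t.K) : ‖star a‖ = ‖a‖ := by
  rcases eq_or_ne a 0 with rfl | ha
  · simp
  · have h := congrArg norm (Family.star_mul_self t a)
    rw [norm_mul, norm_algebraMap', Real.norm_of_nonneg (by positivity), sq] at h
    exact mul_right_cancel₀ (norm_ne_zero_iff.2 ha) h

/-- The function `|⟨(a,1),(w,1)⟩| / √(-⟨(a,1),(a,1)⟩)`, whose logarithm on the boundary is the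
Busemann function pointed at the origin. -/
def horo (a w : Fin n → t.K) : ℝ :=
  ‖1 - ∑ i, star (a i) * w i‖ / √(1 - ∑ i, ‖a i‖ ^ 2)

/-- The termwise bound `|a||w| ≤ (|a|² + |w|²) / 2` replaces Cauchy–Schwarz and keeps the sum
strictly below `1` in norm. -/
theorem one_sub_sum_ne_zero {a w : Fin n → t.K} (ha : ∑ i, ‖a i‖ ^ 2 < 1)
    (hw : ∑ i, ‖w i‖ ^ 2 ≤ 1) : 1 - ∑ i, star (a i) * w i ≠ 0 := by
  intro h
  have h1 : ‖∑ i, star (a i) * w i‖ = 1 := by rw [← sub_eq_zero.1 h, norm_one]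
  have h2 : ‖∑ i, star (a i) * w i‖ ≤ ∑ i, (‖a i‖ ^ 2 + ‖w i‖ ^ 2) / 2 := by
    refine (norm_sum_le _ _).trans (Finset.sum_le_sum fun i _ => ?_)
    rw [norm_mul, norm_star_eq]
    linarith [two_mul_le_add_sq ‖a i‖ ‖w i‖]
  rw [← Finset.sum_div, Finset.sum_add_distrib] at h2
  linarith

theorem horo_pos {a w : Fin n → t.K} (ha : ∑ i, ‖a i‖ ^ 2 < 1) (hw : ∑ i, ‖w i‖ ^ 2 ≤ 1) :
    0 < horo a w :=
  div_pos (norm_pos_iff.2 (one_sub_sum_ne_zero ha hw)) (Real.sqrt_pos.2 (sub_pos.2 ha))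

theorem continuous_horo (a : Fin n → t.K) : Continuous (horo a) := by
  unfold horo
  fun_prop

/-- Factor `x` out of `x + √(x² - 1)` inside the logarithm. -/
theorem tendsto_arcosh_sub_log :
    Tendsto (fun x : ℝ => Real.arcosh x - Real.log x) atTop (𝓝 (Real.log 2)) := by
  have h : Tendsto (fun x : ℝ => Real.log (1 + √(1 - x⁻¹ ^ 2))) atTop (𝓝 (Real.log 2)) := by
    have h0 : Tendsto (fun x : ℝ => 1 + √(1 - x⁻¹ ^ 2)) atTop (𝓝 (1 + √(1 - 0 ^ 2))) :=
      ((tendsto_inv_atTop_zero.pow 2).const_sub 1).sqrt.const_add 1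
    have h2 : (1 + √(1 - 0 ^ 2) : ℝ) = 2 := by norm_num
    rw [h2] at h0
    exact h0.log two_ne_zero
  refine h.congr' ?_
  filter_upwards [eventually_gt_atTop 0] with x hx
  have h1 : x + √(x ^ 2 - 1) = x * (1 + √(1 - x⁻¹ ^ 2)) := by
    have : x ^ 2 - 1 = x ^ 2 * (1 - x⁻¹ ^ 2) := by field_simp
    rw [this, Real.sqrt_mul (sq_nonneg x), Real.sqrt_sq hx.le]
    ring
  rw [Real.arcosh, h1, Real.log_mul hx.ne' (by positivity)]
  ring

theorem hdist_eq_arcosh_horo_mul (a w : Hyp t n) :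
    hdist a w = Real.arcosh (horo a.1 w.1 * (√(1 - ∑ i, ‖w.1 i‖ ^ 2))⁻¹) := by
  rw [hdist, horo, Real.sqrt_mul (sub_nonneg.2 a.2.le), ← div_eq_mul_inv, div_div]

theorem horo_origin (w : Fin n → t.K) : horo (origin : Hyp t n).1 w = 1 := by
  simp [horo, origin]

/-- Both distances are `arcosh` of a `horo` value times the same factor, which blows up at the
boundary; replacing `arcosh` by `log` cancels that factor. Only convergence to `ξ` is used, so the
limit does not depend on the ray. -/
theorem tendsto_hdist_sub_hdist_origin (a : Hyp t n) (ξ : Bdry t n) {c : ℝ → Hyp t n}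
    (hc : Tendsto (fun s => (c s).1) atTop (𝓝 ξ.1)) :
    Tendsto (fun s => hdist a (c s) - hdist origin (c s)) atTop
      (𝓝 (Real.log (horo a.1 ξ.1))) := by
  have hQ : Tendsto (fun s => horo a.1 (c s).1) atTop (𝓝 (horo a.1 ξ.1)) :=
    ((continuous_horo a.1).tendsto _).comp hc
  have hQ0 : 0 < horo a.1 ξ.1 := horo_pos a.2 ξ.2.le
  have hpos : ∀ s, 0 < √(1 - ∑ i, ‖(c s).1 i‖ ^ 2) := fun s => Real.sqrt_pos.2 (sub_pos.2 (c s).2)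
  have hy : Tendsto (fun s => (√(1 - ∑ i, ‖(c s).1 i‖ ^ 2))⁻¹) atTop atTop := by
    refine Tendsto.inv_tendsto_nhdsGT_zero (tendsto_nhdsWithin_iff.2 ⟨?_, .of_forall hpos⟩)
    have hcont : Continuous fun z : Fin n → t.K => √(1 - ∑ i, ‖z i‖ ^ 2) := by fun_prop
    have := (hcont.tendsto ξ.1).comp hc
    rwa [ξ.2, sub_self, Real.sqrt_zero] at this
  have hx : Tendsto (fun s => horo a.1 (c s).1 * (√(1 - ∑ i, ‖(c s).1 i‖ ^ 2))⁻¹) atTop atTop :=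
    hQ.pos_mul_atTop hQ0 hy
  have h := ((tendsto_arcosh_sub_log.comp hx).sub (tendsto_arcosh_sub_log.comp hy)).add
    (hQ.log hQ0.ne')
  rw [sub_self, zero_add] at h
  refine h.congr fun s => ?_
  rw [hdist_eq_arcosh_horo_mul, hdist_eq_arcosh_horo_mul, horo_origin, one_mul]
  simp only [Function.comp]
  rw [Real.log_mul (horo_pos a.2 (c s).2.le).ne' (inv_ne_zero (hpos s).ne')]
  ring

/-! ### Radial geodesics from the origin -/

theorem norm_smul_coord_sq (r : ℝ) (z : Fin n → t.K) :
    ∑ i, ‖(r • z) i‖ ^ 2 = r ^ 2 * ∑ i, ‖z i‖ ^ 2 := by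
  simp only [Pi.smul_apply, norm_smul, mul_pow, Real.norm_eq_abs, sq_abs, Finset.mul_sum]

/-- The geodesic ray from the origin to `ξ`. -/
def originRay (ξ : Bdry t n) (s : ℝ) : Hyp t n :=
  ⟨Real.tanh s • ξ.1, by
    rw [norm_smul_coord_sq, ξ.2, mul_one]
    exact Real.tanh_sq_lt_one s⟩

theorem one_sub_tanh_sq (s : ℝ) : 1 - Real.tanh s ^ 2 = (Real.cosh s ^ 2)⁻¹ := by
  have := Real.cosh_sq s
  have h0 := (Real.cosh_pos s).ne'
  rw [Real.tanh_eq_sinh_div_cosh]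
  field_simp
  linarith

theorem tendsto_tanh_atTop : Tendsto Real.tanh atTop (𝓝 1) := by
  have he : Tendsto (fun s : ℝ => Real.exp (-(2 * s))) atTop (𝓝 0) :=
    Real.tendsto_exp_neg_atTop_nhds_zero.comp (tendsto_id.const_mul_atTop two_pos)
  have h := (he.const_sub 1).div (he.const_add 1) (by norm_num)
  rw [sub_zero, add_zero, div_one] at h
  refine h.congr fun s => ?_
  have hs : Real.exp (-(2 * s)) = (Real.exp s)⁻¹ * (Real.exp s)⁻¹ := by
    rw [← Real.exp_neg, ← Real.exp_add]
    ring_nf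
  have h0 := Real.exp_pos s
  rw [Real.tanh_eq, Pi.div_apply, hs, Real.exp_neg]
  field_simp

theorem star_smul_mul_smul (s r : ℝ) (x : t.K) :
    star (s • x) * (r • x) = algebraMap ℝ t.K (s * r * ‖x‖ ^ 2) := by
  have h : star (algebraMap ℝ t.K s) = algebraMap ℝ t.K s := by
    rcases t with _ | _ | _
    · rfl
    · exact Complex.conj_ofReal s
    · exact Quaternion.star_coe s
  rw [Algebra.smul_def, star_mul, h, ← Algebra.commutes, mul_assoc, mul_smul_comm,
    Family.star_mul_self, Algebra.smul_def, ← map_mul, ← map_mul, mul_assoc]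

theorem hdist_originRay (ξ : Bdry t n) (s r : ℝ) :
    hdist (originRay ξ s) (originRay ξ r) = |s - r| := by
  have h1 : ∀ s, 1 - ∑ i, ‖(originRay ξ s).1 i‖ ^ 2 = (Real.cosh s ^ 2)⁻¹ := fun s => by
    rw [← one_sub_tanh_sq]
    simp only [originRay]
    rw [norm_smul_coord_sq, ξ.2, mul_one]
  have h2 : 1 - ∑ i, star ((originRay ξ s).1 i) * (originRay ξ r).1 i =
      algebraMap ℝ t.K (1 - Real.tanh s * Real.tanh r) := by
    simp only [originRay, Pi.smul_apply, star_smul_mul_smul]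
    rw [← map_sum, ← Finset.mul_sum, ξ.2, mul_one, map_sub, map_one]
  have hs := Real.cosh_pos s
  have hr := Real.cosh_pos r
  -- The subtraction formula for `cosh` is what makes `tanh` the unit speed parametrization.
  have h3 : 1 - Real.tanh s * Real.tanh r = Real.cosh (s - r) / (Real.cosh s * Real.cosh r) := by
    rw [Real.cosh_sub, Real.tanh_eq_sinh_div_cosh, Real.tanh_eq_sinh_div_cosh]
    field_simp
  rw [hdist, h1, h1, h2, h3, norm_algebraMap', Real.norm_of_nonneg
    (div_nonneg (Real.cosh_pos _).le (by positivity)), ← mul_inv, ← mul_pow, Real.sqrt_inv,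
    Real.sqrt_sq (by positivity), div_inv_eq_mul, div_mul_cancel₀ _ (by positivity),
    ← Real.cosh_abs, Real.arcosh_cosh (abs_nonneg _)]

theorem isGeodesicRay_originRay (ξ : Bdry t n) : IsGeodesicRay (originRay ξ) origin ξ where
  start := Subtype.ext (by funext i; simp [originRay, origin])
  isometry s r _ _ := hdist_originRay ξ s r
  tendsto := by
    have h : Tendsto (fun s => Real.tanh s • ξ.1) atTop (𝓝 ((1 : ℝ) • ξ.1)) :=
      tendsto_tanh_atTop.smul_const ξ.1
    rwa [one_smul] at h

/-- The radial ray shows that the choice in `busemann` is from a nonempty set; whichever ray is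
chosen, uniqueness of limits gives this value. -/
theorem busemann_origin (a : Hyp t n) (ξ : Bdry t n) :
    busemann origin a ξ = Real.log (horo a.1 ξ.1) := by
  have h : ∃ r : ℝ, ∃ c : ℝ → Hyp t n, IsGeodesicRay c origin ξ ∧
      Tendsto (fun s => hdist a (c s) - hdist origin (c s)) atTop (𝓝 r) :=
    ⟨_, originRay ξ, isGeodesicRay_originRay ξ,
      tendsto_hdist_sub_hdist_origin a ξ (isGeodesicRay_originRay ξ).tendsto⟩
  obtain ⟨c, hc, hlim⟩ := Classical.epsilon_spec h
  exact tendsto_nhds_unique hlim (tendsto_hdist_sub_hdist_origin a ξ hc.tendsto)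

/-! ### Behaviour of Busemann functions under the isometry group -/

theorem form_lift (a w : Fin n → t.K) :
    star (lift a) ⬝ᵥ (J t n *ᵥ lift w) = -(1 - ∑ i, star (a i) * w i) := by
  simp only [J, Matrix.mulVec_diagonal, dotProduct, Fintype.sum_sum_type, Pi.star_apply,
    Sum.elim_inl, Sum.elim_inr, lift]
  simp [sub_eq_add_neg]

/-- The form is `A`-invariant, so only the renormalization of the last coordinate to `1` matters.
The factor of `a` cancels between numerator and square root; that of `w` survives. -/
theorem horo_act (A : U t n) {a w : Fin n → t.K} (ha : ∑ i, ‖a i‖ ^ 2 < 1)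
    (hw : ∑ i, ‖w i‖ ^ 2 ≤ 1) :
    horo (act A.1.1 a) (act A.1.1 w) = horo a w / ‖(A.1.1 *ᵥ lift w) (Sum.inr ())‖ := by
  have h0a := denom_ne_zero A ha.le
  have hna : 0 < ‖(A.1.1 *ᵥ lift a) (Sum.inr ())‖ := norm_pos_iff.2 h0a
  have hnum : 1 - ∑ i, star (act A.1.1 a i) * act A.1.1 w i =
      star ((A.1.1 *ᵥ lift a) (Sum.inr ()))⁻¹ * (1 - ∑ i, star (a i) * w i) *
        ((A.1.1 *ᵥ lift w) (Sum.inr ()))⁻¹ := by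
    have hinv : star (A.1.1 *ᵥ lift a) ⬝ᵥ (J t n *ᵥ (A.1.1 *ᵥ lift w)) =
        star (lift a) ⬝ᵥ (J t n *ᵥ lift w) := by
      have h : (A.1.1)ᴴ * J t n * A.1.1 = J t n := A.2
      rw [Matrix.star_mulVec, ← Matrix.dotProduct_mulVec, Matrix.mulVec_mulVec,
        Matrix.mulVec_mulVec, h]
    rw [← neg_inj, ← form_lift, ← neg_mul, ← mul_neg, ← form_lift, ← hinv, lift_act A ha.le,
      lift_act A hw]
    simp only [dotProduct, J, Matrix.mulVec_diagonal, Pi.star_apply, star_mul, Finset.mul_sum,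
      Finset.sum_mul, mul_assoc]
  have hden : 1 - ∑ i, ‖act A.1.1 a i‖ ^ 2 =
      (1 - ∑ i, ‖a i‖ ^ 2) / ‖(A.1.1 *ᵥ lift a) (Sum.inr ())‖ ^ 2 := by
    rw [← neg_inj, neg_sub, norm_act A ha.le, ← neg_div, neg_sub]
  rw [horo, horo, hnum, hden, Real.sqrt_div (sub_nonneg.2 ha.le), Real.sqrt_sq hna.le, norm_mul,
    norm_mul, norm_star_eq, norm_inv, norm_inv]
  field_simp

/-- The factor in `horo_act` is independent of `a`, so it can be evaluated at the origin, where
`horo` is `1`. -/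
theorem log_horo_smul (g : G t n) (a : Hyp t n) (ξ : Bdry t n) :
    Real.log (horo (g • a).1 (g • ξ).1) =
      Real.log (horo a.1 ξ.1) + Real.log (horo (g • (origin : Hyp t n)).1 (g • ξ).1) := by
  obtain ⟨A, rfl⟩ := QuotientGroup.mk_surjective (s := Z t n) g
  change Real.log (horo (act A.1.1 a.1) (act A.1.1 ξ.1)) = Real.log (horo a.1 ξ.1) +
    Real.log (horo (act A.1.1 (origin : Hyp t n).1) (act A.1.1 ξ.1))
  rw [horo_act A a.2 ξ.2.le, horo_act A (origin : Hyp t n).2 ξ.2.le, horo_origin,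
    div_eq_mul_one_div, Real.log_mul (horo_pos a.2 ξ.2.le).ne'
      (one_div_ne_zero (norm_ne_zero_iff.2 (denom_ne_zero A ξ.2.le)))]

end Busemann

/-! ### Barycenters -/

section Barycenter

variable {t : Family} {n : ℕ}

theorem continuous_log_horo (a : Hyp t n) :
    Continuous fun ξ : Bdry t n => Real.log (horo a.1 ξ.1) :=
  ((continuous_horo a.1).comp continuous_subtype_val).log fun ξ => (horo_pos a.2 ξ.2.le).ne'

theorem bFunctional_map_smul (ν : Measure (Bdry t n)) [IsFiniteMeasure ν] (g : G t n)
    (a : Hyp t n) :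
    bFunctional (ν.map fun ξ => g • ξ) (g • a) = bFunctional ν a +
      ∫ ξ, Real.log (horo (g • (origin : Hyp t n)).1 ((g • ξ : Bdry t n)).1) ∂ν := by
  have hg : Continuous fun ξ : Bdry t n => g • ξ := continuous_const_smul g
  simp only [bFunctional, busemann_origin]
  rw [integral_map hg.aemeasurable (continuous_log_horo _).aestronglyMeasurable]
  simp only [log_horo_smul g a]
  -- Continuous functions on the compact boundary are integrable for a finite measure.
  exact integral_add
    ((continuous_log_horo a).integrable_of_hasCompactSupport (.of_compactSpace _))
    (((continuous_log_horo (g • (origin : Hyp t n))).comp hg).integrable_of_hasCompactSupport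
      (.of_compactSpace _))

theorem IsBarycenter.map_smul {ν : Measure (Bdry t n)} [IsFiniteMeasure ν] {p : Hyp t n}
    (h : IsBarycenter ν p) (g : G t n) : IsBarycenter (ν.map fun ξ => g • ξ) (g • p) := by
  refine ⟨fun ξ => ?_, fun q hq => ?_⟩
  · rw [Measure.map_apply (measurable_const_smul g) (measurableSet_singleton ξ)]
    have : (fun η : Bdry t n => g • η) ⁻¹' {ξ} = {g⁻¹ • ξ} := by
      ext η
      simp [eq_inv_smul_iff]
    rw [this]
    exact h.1 _
  · obtain ⟨q, rfl⟩ := MulAction.surjective g q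
    rw [bFunctional_map_smul, bFunctional_map_smul]
    exact add_lt_add_left (h.2 q fun h' => hq (h' ▸ rfl)) _

theorem IsBarycenter.eq {ν : Measure (Bdry t n)} {p q : Hyp t n} (hp : IsBarycenter ν p)
    (hq : IsBarycenter ν q) : p = q := by
  by_contra hne
  exact lt_asymm (hp.2 q (Ne.symm hne)) (hq.2 p hne)

end Barycenter

/-! ### Twisted cocycles -/

section Cocycle

variable {t : Family} {n m : ℕ} {Γ : Subgroup (G t n)} {X : Type*} [MeasurableSpace X]
  [MulAction Γ X] {μ : Measure X} {σ : Γ × X → G t m} {f : X → G t m}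

theorem IsCocycle.twist [DiscreteTopology Γ] [MeasurableConstSMul Γ X] (hσ : IsCocycle μ σ)
    (hf : Measurable f) : IsCocycle μ (twist σ f) where
  measurable := by
    have := countable_of_discreteTopology Γ
    have : MeasurableSingletonClass Γ := ⟨fun γ => (isOpen_discrete {γ}).measurableSet⟩
    -- A lattice is discrete in a second countable group, hence countable, so measurability can be
    -- checked for each fixed `γ`.
    have h : Measurable fun p : Γ × X => f (p.1 • p.2) :=
      measurable_from_prod_countable_right fun γ => hf.comp (measurable_const_smul γ)
    exact (h.inv.mul hσ.measurable).mul (hf.comp measurable_snd)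
  cocycle γ₁ γ₂ := by
    filter_upwards [hσ.cocycle γ₁ γ₂] with x hx
    simp only [HypCocycle.twist, hx, mul_smul]
    group

/-- This makes twisting of boundary maps reversible, which is how essential uniqueness passes to the
twisted cocycle. -/
theorem twist_twist_inv {X : Type*} [MulAction Γ X] (σ : Γ × X → G t m) (f : X → G t m) :
    twist (twist σ f) (fun x => (f x)⁻¹) = σ := by
  funext p
  simp only [twist]
  group

theorem IsBoundaryMap.twist {κ : Measure (Bdry t n)} {φ : Bdry t n × X → Bdry t m}
    (hφ : IsBoundaryMap κ μ σ φ) (hf : Measurable f) :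
    IsBoundaryMap κ μ (twist σ f) fun p => (f p.2)⁻¹ • φ p where
  measurable := (hf.comp measurable_snd).inv.smul hφ.measurable
  equivariant γ := by
    filter_upwards [hφ.equivariant γ] with p hp
    simp only [hp, HypCocycle.twist, smul_smul, mul_inv_cancel_right]

theorem ae_ae_snd_of_ae_prod {α β : Type*} [MeasurableSpace α] [MeasurableSpace β]
    {κ : Measure α} {μ : Measure β} [SFinite κ] [SFinite μ] {p : α × β → Prop}
    (h : ∀ᵐ z ∂(κ.prod μ), p z) : ∀ᵐ y ∂μ, ∀ᵐ x ∂κ, p (x, y) :=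
  Measure.ae_ae_of_ae_prod (Measure.measurePreserving_swap.quasiMeasurePreserving.ae h)

theorem IsNaturalMap.twist {ν : Hyp t n → Measure (Bdry t n)} [∀ a, IsFiniteMeasure (ν a)]
    {F : Hyp t n × X → Hyp t m} (hF : IsNaturalMap ν μ σ F) (hf : Measurable f) :
    IsNaturalMap ν μ (twist σ f) fun p => (f p.2)⁻¹ • F p := by
  obtain ⟨hFm, φ, hφ, huniq, hinj, hbar⟩ := hF
  refine ⟨(hf.comp measurable_snd).inv.smul hFm, fun p => (f p.2)⁻¹ • φ p, hφ.twist hf,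
    fun ψ hψ => ?_, ?_, ?_⟩
  -- Untwisting `ψ` by `f⁻¹` gives a boundary map of `σ`, to be compared with `φ`.
  · have h := hψ.twist hf.inv
    rw [show f⁻¹ = fun x => (f x)⁻¹ from rfl, twist_twist_inv] at h
    filter_upwards [huniq _ h] with p hp
    rw [← hp, inv_inv, inv_smul_smul]
  · filter_upwards [hinj] with x ⟨S, hS, hSinj⟩
    exact ⟨S, hS, fun ξ hξ η hη h => hSinj hξ hη (MulAction.injective _ h)⟩
  · filter_upwards [hbar] with x hx a
    have hφx : Measurable fun ξ => φ (ξ, x) := hφ.measurable.comp measurable_prodMk_right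
    have h := (hx a).map_smul (f x)⁻¹
    rwa [Measure.map_map (measurable_const_smul _) hφx] at h

/-- The exceptional null set of `x` is chosen for `ν origin` alone; absolute continuity then handles
all `a` simultaneously. -/
theorem IsNaturalMap.ae_eq {ν : Hyp t n → Measure (Bdry t n)} [SFinite μ]
    [SFinite (ν origin)] (hν : ∀ a, ν a ≪ ν origin) {F F' : Hyp t n × X → Hyp t m}
    (hF : IsNaturalMap ν μ σ F) (hF' : IsNaturalMap ν μ σ F') :
    ∀ᵐ x ∂μ, ∀ a, F' (a, x) = F (a, x) := by
  obtain ⟨-, φ, -, huniq, -, hbar⟩ := hF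
  obtain ⟨-, φ', hφ', -, -, hbar'⟩ := hF'
  filter_upwards [hbar, hbar', ae_ae_snd_of_ae_prod (huniq φ' hφ')] with x hx hx' hφx a
  have h := hx' a
  rw [Measure.map_congr ((hν a).ae_le hφx)] at h
  exact h.eq (hx a)

end Cocycle

end

end HypCocycle

theorem mainTheorem7 (t : HypCocycle.Family) (n m : ℕ)
    (hd : 2 ≤ Module.finrank ℝ t.K * (n - 1)) (hnm : n ≤ m)
    (Γ : Subgroup (HypCocycle.G t n)) (hΓ : HypCocycle.IsTorsionFreeUniformLattice Γ)
    (ν : HypCocycle.Hyp t n → Measure (HypCocycle.Bdry t n))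
    (hν : HypCocycle.IsPattersonSullivan Γ ν)
    {X : Type*} [MeasurableSpace X] [StandardBorelSpace X] [MulAction Γ X]
    [MeasurableConstSMul Γ X] (μ : Measure X) [IsProbabilityMeasure μ] [NullSingletonClass μ]
    [SMulInvariantMeasure Γ X μ]
    (σ : Γ × X → HypCocycle.G t m) (hσ : HypCocycle.IsCocycle μ σ)
    (F : HypCocycle.Hyp t n × X → HypCocycle.Hyp t m) (hF : HypCocycle.IsNaturalMap ν μ σ F)
    (f : X → HypCocycle.G t m) (hf : Measurable f) :
    HypCocycle.IsCocycle μ (HypCocycle.twist σ f) ∧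
    HypCocycle.IsNaturalMap ν μ (HypCocycle.twist σ f) (fun p => (f p.2)⁻¹ • F p) ∧
    ∀ F' : HypCocycle.Hyp t n × X → HypCocycle.Hyp t m,
      HypCocycle.IsNaturalMap ν μ (HypCocycle.twist σ f) F' →
      ∀ᵐ x ∂μ, ∀ a, F' (a, x) = (f x)⁻¹ • F (a, x) := by

  have hprob := hν.prob
  have := hΓ.discrete
  have hac : ∀ a, ν a ≪ ν HypCocycle.origin := fun a => by
    -- Conformality is imposed only at distinct points; the diagonal case is trivial.
    rcases eq_or_ne a HypCocycle.origin with rfl | ha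
    · exact .rfl
    · exact hν.absCont _ _ ha
  exact ⟨hσ.twist hf, hF.twist hf, fun F' hF' => (hF.twist hf).ae_eq hac hF'⟩
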